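/- Let $\mathcal I_n(321)$ be the set of involutions $\pi$ in the symmetric group $S_n$ ($\pi^2=1$, the identity included) that avoid the pattern $321$, i.e. for which there are no $i<j<k$ with $\pi(i)>\pi(j)>\pi(k)$. For $\pi\in S_n$ let $\mathrm{Des}(\pi)=\{i : 1\le i<n,\ \pi(i)>\pi(i+1)\}$, let $\mathrm{des}(\pi)=|\mathrm{Des}(\pi)|$ and $\mathrm{maj}(\pi)=\sum_{i\in\mathrm{Des}(\pi)} i$, and let $\mathrm{fp}(\pi)$ be the number of fixed points of $\pi$. For integers $m,k\ge 0$ let $\binom{m}{k}_q$ be the $q$-binomial coefficient, a polynomial in the indeterminate $q$, which is $0$ if $k>m$; put $\binom{m}{k}_q=0$ if $m<0$ and $k\ge 0$. 1. For all integers $b\ge a\ge 0$ and $k\ge 0$, $$\sum_{\substack{\pi\in\mathcal I_{a+b}(321)\\ \mathrm{fp}(\pi)\ge b-a\\ \mathrm{des}(\pi)=k}} q^{\mathrm{maj}(\pi)}=q^{k^2}\binom{a}{k}_q\binom{b}{k}_q.$$ 2. For all integers $n,\ell,k\ge 0$ with $\ell\equiv n \pmod 2$, $$\sum_{\substack{\pi\in\mathcal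 I_{n}(321)\\ \mathrm{fp}(\pi)=\ell\\ \mathrm{des}(\pi)=k}} q^{\mathrm{maj}(\pi)}=q^{k^2}\left[\binom{\frac{n-\ell}{2}}{k}_q\binom{\frac{n+\ell}{2}}{k}_q-\binom{\frac{n-\ell}{2}-1}{k}_q\binom{\frac{n+\ell}{2}+1}{k}_q\right].$$ -/

import Mathlib

open Polynomial

/-- The set of descent positions of `π ∈ S_m`, numbered as usual by `1, …, m - 1`.
Since `Fin m` is `{0, …, m - 1}`, positions `d` and `d + 1` of the one-line notation are the
elements `d - 1` and `d` of `Fin m`. -/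
def permDes {m : ℕ} (π : Equiv.Perm (Fin m)) : Finset ℕ :=
  {d ∈ Finset.range m | ∃ i j : Fin m, (i : ℕ) + 1 = d ∧ (j : ℕ) = d ∧ π j < π i}

/-- The number of descents. -/
def permDesNum {m : ℕ} (π : Equiv.Perm (Fin m)) : ℕ := (permDes π).card

/-- The major index: the sum of the descent positions. -/
def permMaj {m : ℕ} (π : Equiv.Perm (Fin m)) : ℕ := ∑ d ∈ permDes π, d

/-- The number of fixed points. -/
def permFp {m : ℕ} (π : Equiv.Perm (Fin m)) : ℕ :=
  (Finset.univ.filter fun i : Fin m => π i = i).card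

/-- `π` avoids the pattern `τ`: no subsequence of the one-line notation of `π` has its entries in
the same relative order as the one-line notation of `τ`. -/
def AvoidsPattern {m k : ℕ} (π : Equiv.Perm (Fin m)) (τ : Equiv.Perm (Fin k)) : Prop :=
  ¬ ∃ f : Fin k → Fin m, StrictMono f ∧ ∀ i j : Fin k, π (f i) < π (f j) ↔ τ i < τ j

open Classical in
/-- The set of `321`-avoiding involutions in `S_n`. The pattern `321` is the order-reversing
permutation of three letters. -/
noncomputable def involutions321 (n : ℕ) : Finset (Equiv.Perm (Fin n)) :=
  {π | Function.Involutive π ∧ AvoidsPattern π (Fin.revPerm : Equiv.Perm (Fin 3))}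

/-- The `q`-binomial coefficient for natural numbers, as a polynomial in `q = X`, through the
`q`-Pascal recursion. -/
noncomputable def gaussBinom : ℕ → ℕ → ℤ[X]
  | _, 0 => 1
  | 0, _ + 1 => 0
  | n + 1, k + 1 => gaussBinom n k + X ^ (k + 1) * gaussBinom n (k + 1)

/-- The `q`-integer `1 + q + ⋯ + q ^ (n - 1)`. -/
noncomputable def qInt (n : ℕ) : ℤ[X] := ∑ i ∈ Finset.range n, X ^ i

/-- The `q`-factorial. -/
noncomputable def qFact (n : ℕ) : ℤ[X] := ∏ i ∈ Finset.range n, qInt (i + 1)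

theorem qInt_add (m n : ℕ) : qInt (m + n) = qInt m + X ^ m * qInt n := by
  simp [qInt, Finset.sum_range_add, pow_add, Finset.mul_sum]

theorem gaussBinom_eq_zero_of_lt {n k : ℕ} (h : n < k) : gaussBinom n k = 0 := by
  induction n generalizing k with
  | zero => obtain ⟨k, rfl⟩ := Nat.exists_eq_succ_of_ne_zero (by omega : k ≠ 0); rfl
  | succ n ih =>
    obtain ⟨k, rfl⟩ := Nat.exists_eq_succ_of_ne_zero (by omega : k ≠ 0)
    simp [gaussBinom, ih (show n < k by omega), ih (show n < k + 1 by omega)]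

theorem gaussBinom_zero_right (n : ℕ) : gaussBinom n 0 = 1 := by
  cases n <;> rfl

/-- The recursion gives the usual quotient of `q`-factorials. -/
theorem gaussBinom_mul_qFact (j k : ℕ) :
    gaussBinom (j + k) k * (qFact k * qFact j) = qFact (j + k) := by
  induction k generalizing j with
  | zero => simp [gaussBinom_zero_right, qFact]
  | succ k ihk =>
    induction j with
    | zero =>
      have h := ihk 0
      have e : gaussBinom (0 + (k + 1)) (k + 1) = gaussBinom (0 + k) k := by
        rw [show 0 + (k + 1) = k + 1 by omega, gaussBinom,
          gaussBinom_eq_zero_of_lt (show k < k + 1 by omega)]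
        simp
      have f : ∀ n, qFact (n + 1) = qFact n * qInt (n + 1) := fun n =>
        Finset.prod_range_succ _ _
      rw [e, f, show 0 + (k + 1) = (0 + k) + 1 by omega, f, ← h]
      simp
      ring
    | succ j ihj =>
      have f : ∀ n, qFact (n + 1) = qFact n * qInt (n + 1) := fun n =>
        Finset.prod_range_succ _ _
      have h1 := ihk (j + 1)
      have e : j + 1 + (k + 1) = (j + 1 + k) + 1 := by omega
      have e2 : j + (k + 1) = j + 1 + k := by omega
      rw [e2] at ihj
      rw [e, gaussBinom, f (j + 1 + k), show j + 1 + k + 1 = (k + 1) + (j + 1) by omega,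
        qInt_add (k + 1) (j + 1), mul_add]
      nth_rewrite 2 [← ihj]
      rw [← h1, f k, f j]
      ring

/-- The `q`-binomial coefficient with an integer on top, which is zero if the top is negative. -/
noncomputable def qBinom (m : ℤ) (k : ℕ) : ℤ[X] :=
  if 0 ≤ m then gaussBinom m.toNat k else 0

/-! ### The closed form -/

/-! Mark each excedance of a 321-avoiding involution by `1`, each anti-excedance by `-1` and each
fixed point by `0`. Avoidance forces the involution to send the `r`-th `1` to the `r`-th `-1`, so
the word determines it. The words that arise are the nonnegative paths ending at height zero whose
level steps lie at height zero. Descents become peaks (`1` followed by `-1`) at the same positions.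

It remains to count such words, with arbitrary final height `h` and `f` level steps. Removing the
last letter gives a recursion in which only `h + f = b - a` and the length `a + b` matter: an up
step and a level step at height zero both lower `h + f` by one. The reflection difference `ballotGF`
of the closed form `latticeGF` satisfies the same recursion and vanishes at `b = a - 1`, so the two
agree (`wordGF_eq_ballotGF`).

Taking `h = 0` and `f = l` gives the second formula. The first follows by telescoping these
differences over the numbers of fixed points that are at least `b - a`. -/

theorem gaussBinom_succ_right_mul (n m : ℕ) :
    (X ^ (m + 1) - 1) * X ^ m * gaussBinom n (m + 1) = (X ^ n - X ^ m) * gaussBinom n m := by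
  induction n generalizing m with
  | zero =>
    cases m with
    | zero => simp [gaussBinom]
    | succ m => simp [gaussBinom]
  | succ n ih =>
    cases m with
    | zero =>
      have := ih 0
      simp only [gaussBinom, gaussBinom_zero_right] at this ⊢
      linear_combination X * this
    | succ m =>
      have h1 := ih m
      have h2 := ih (m + 1)
      simp only [gaussBinom]
      linear_combination X ^ (m + 2) * h2 + X * h1

/-- The other `q`-Pascal rule, whose factor `q ^ (n - m)` is cleared to avoid subtraction in the
exponent. -/
theorem X_pow_mul_gaussBinom_sub (n m : ℕ) :
    X ^ m * (gaussBinom (n + 1) (m + 1) - gaussBinom n (m + 1)) = X ^ n * gaussBinom n m := by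
  have := gaussBinom_succ_right_mul n m
  simp only [gaussBinom]
  linear_combination this

/-- The generating function of lattice words with `a` down-letters, `b` up-letters and `k` peaks. -/
noncomputable def latticeGF (a b k : ℤ) : ℤ[X] :=
  if 0 ≤ k then X ^ (k.toNat ^ 2) * qBinom a k.toNat * qBinom b k.toNat else 0

theorem latticeGF_comm (a b k : ℤ) : latticeGF a b k = latticeGF b a k := by
  unfold latticeGF
  split_ifs
  · ring
  · rfl

theorem latticeGF_of_neg_left {a : ℤ} (ha : a < 0) (b k : ℤ) : latticeGF a b k = 0 := by
  simp [latticeGF, qBinom, not_le.2 ha]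

theorem latticeGF_natCast (a b k : ℕ) :
    latticeGF a b k = X ^ (k ^ 2) * gaussBinom a k * gaussBinom b k := by
  simp [latticeGF, qBinom]

/-- Removal of the last letter: a final down step adds a peak, at position `a + b - 1`, exactly when
it follows an up step. Hence the words ending in an up step are subtracted and then added back with
one more peak. -/
theorem latticeGF_rec (a b k : ℤ) (hab : 1 ≤ a + b) (hb : 0 ≤ b) :
    latticeGF a b k = latticeGF a (b - 1) k + latticeGF (a - 1) b k - latticeGF (a - 1) (b - 1) k
      + X ^ (a + b - 1).toNat * latticeGF (a - 1) (b - 1) (k - 1) := by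
  rcases lt_or_ge k 0 with hk | hk
  · simp [latticeGF, not_le.2 hk, show ¬ (1 ≤ k) by omega]
  obtain ⟨k, rfl⟩ := Int.eq_ofNat_of_zero_le hk
  have base : ∀ c : ℤ, 1 ≤ c → latticeGF 0 c k = latticeGF 0 (c - 1) k := by
    intro c hc
    obtain ⟨c, rfl⟩ : ∃ m : ℕ, c = m + 1 := ⟨(c - 1).toNat, by omega⟩
    rw [add_sub_cancel_right]
    rw [show (c : ℤ) + 1 = ((c + 1 : ℕ) : ℤ) by push_cast; ring, show (0 : ℤ) = ((0 : ℕ) : ℤ) by rfl,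
      latticeGF_natCast, latticeGF_natCast]
    cases k <;> simp [gaussBinom, gaussBinom_zero_right]
  rcases lt_trichotomy a 0 with ha | rfl | ha
  · simp [latticeGF_of_neg_left ha, latticeGF_of_neg_left (show a - 1 < 0 by omega)]
  · simp [base b (by omega),
      latticeGF_of_neg_left (show (-1 : ℤ) < 0 by omega)]
  rcases hb.eq_or_lt with rfl | hb
  · have h1 : ∀ x y, latticeGF x (0 - 1) y = 0 := fun x y => by
      rw [latticeGF_comm, latticeGF_of_neg_left (by omega)]
    rw [h1, h1, h1, latticeGF_comm, base a (by omega), latticeGF_comm]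
    simp
  obtain ⟨a, rfl⟩ : ∃ m : ℕ, a = m + 1 := ⟨(a - 1).toNat, by omega⟩
  obtain ⟨b, rfl⟩ : ∃ m : ℕ, b = m + 1 := ⟨(b - 1).toNat, by omega⟩
  simp only [add_sub_cancel_right]
  rw [show ((a : ℤ) + 1 + (b + 1) - 1).toNat = a + b + 1 by omega]
  simp only [show ∀ m : ℕ, (m : ℤ) + 1 = ((m + 1 : ℕ) : ℤ) from fun _ => by push_cast; ring]
  cases k with
  | zero =>
    simp only [latticeGF_natCast, gaussBinom_zero_right]
    simp [latticeGF]
  | succ m =>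
    rw [show ((m + 1 : ℕ) : ℤ) - 1 = (m : ℤ) by push_cast; ring]
    simp only [latticeGF_natCast]
    have h1 := X_pow_mul_gaussBinom_sub a m
    have h2 := X_pow_mul_gaussBinom_sub b m
    -- The terms with `m + 1` peaks form a mixed second difference in `a` and `b`, which factors.
    -- Since `(m + 1) ^ 2 = m ^ 2 + 1 + m + m`, each factor receives the `X ^ m` that its Pascal
    -- rule needs.
    linear_combination X ^ (m ^ 2 + 1) * X ^ m *
      (gaussBinom (b + 1) (m + 1) - gaussBinom b (m + 1)) * h1
      + X ^ (m ^ 2 + 1) * X ^ a * gaussBinom a m * h2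

/-- The generating function of ballot words, by the reflection principle. -/
noncomputable def ballotGF (a b k : ℤ) : ℤ[X] := latticeGF a b k - latticeGF (a - 1) (b + 1) k

theorem ballotGF_of_neg_left {a : ℤ} (ha : a < 0) (b k : ℤ) : ballotGF a b k = 0 := by
  simp [ballotGF, latticeGF_of_neg_left ha, latticeGF_of_neg_left (show a - 1 < 0 by omega)]

theorem ballotGF_reflect (a k : ℤ) : ballotGF a (a - 1) k = 0 := by
  rw [ballotGF, latticeGF_comm, sub_add_cancel, sub_self]

/-- The recursion is linear and its exponent depends only on `a + b`, which reflection preserves. -/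
theorem ballotGF_rec (a b k : ℤ) (hab : 1 ≤ a + b) (hb : 0 ≤ b) :
    ballotGF a b k = ballotGF a (b - 1) k + ballotGF (a - 1) b k - ballotGF (a - 1) (b - 1) k
      + X ^ (a + b - 1).toNat * ballotGF (a - 1) (b - 1) (k - 1) := by
  have h1 := latticeGF_rec a b k hab hb
  have h2 := latticeGF_rec (a - 1) (b + 1) k (by omega) (by omega)
  rw [show a - 1 + (b + 1) = a + b by ring, add_sub_cancel_right] at h2
  simp only [ballotGF, sub_add_cancel]
  linear_combination h1 - h2

/-! ### Words -/

open Classical in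
/-- Words of length `n` in the letters `1, 0, -1`, continued by zeros. -/
noncomputable def signWords : ℕ → Finset (ℕ → SignType)
  | 0 => {0}
  | n + 1 => (Finset.univ ×ˢ signWords n).image fun p => Function.update p.2 n p.1

theorem mem_signWords {n : ℕ} {w : ℕ → SignType} : w ∈ signWords n ↔ ∀ i, n ≤ i → w i = 0 := by
  induction n generalizing w with
  | zero => simp [signWords, funext_iff]
  | succ n ih =>
    simp only [signWords, Finset.mem_image, Finset.mem_product, Finset.mem_univ, true_and,
      Prod.exists]
    constructor
    · rintro ⟨c, v, hv, rfl⟩ i hi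
      rw [Function.update_of_ne (by omega)]
      exact ih.1 hv i (by omega)
    · intro h
      refine ⟨w n, Function.update w n 0, ih.2 fun i hi => ?_, by simp⟩
      rcases hi.eq_or_lt with rfl | hi
      · simp
      · rw [Function.update_of_ne hi.ne']
        exact h i hi

theorem sum_signWords_succ {M : Type*} [AddCommMonoid M] (n : ℕ) (F : (ℕ → SignType) → M) :
    ∑ w ∈ signWords (n + 1), F w =
      (∑ w ∈ signWords n, F (Function.update w n 1)
        + ∑ w ∈ signWords n, F (Function.update w n 0))
        + ∑ w ∈ signWords n, F (Function.update w n (-1)) := by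
  classical
  rw [signWords, Finset.sum_image, Finset.sum_product]
  · rw [show (Finset.univ : Finset SignType) = {1, 0, -1} by decide]
    simp [add_assoc]
  · rintro ⟨c, v⟩ hv ⟨d, u⟩ hu h
    simp only [Finset.coe_product, Set.mem_prod, Finset.mem_coe, mem_signWords] at hv hu h
    have hcd : c = d := by simpa using congrFun h n
    refine Prod.ext hcd (funext fun i => ?_)
    by_cases hi : i = n
    · rw [hi]
      exact (hv.2 n le_rfl).trans (hu.2 n le_rfl).symm
    · simpa [hi] using congrFun h i

/-- The height of the path after `n` letters. -/
def wordHeight (w : ℕ → SignType) (n : ℕ) : ℤ := ∑ i ∈ Finset.range n, (w i : ℤ)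

/-- The number of zeros among the first `n` letters. -/
def wordZeros (w : ℕ → SignType) (n : ℕ) : ℕ := {i ∈ Finset.range n | w i = 0}.card

open Classical in
/-- The positions of the peaks among the first `n` letters. -/
noncomputable def wordPeaks (w : ℕ → SignType) (n : ℕ) : Finset ℕ :=
  {d ∈ Finset.range n | ∃ i, i + 1 = d ∧ w i = 1 ∧ w d = -1}

/-- The path stays nonnegative and its level steps are at height zero. -/
def IsMotzkinPrefix (w : ℕ → SignType) (n : ℕ) : Prop :=
  (∀ i ≤ n, 0 ≤ wordHeight w i) ∧ ∀ i < n, w i = 0 → wordHeight w i = 0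

/-! ### Appending a letter -/

section update
variable (w : ℕ → SignType) (n : ℕ) (c : SignType)

theorem wordHeight_update_of_le {i : ℕ} (hi : i ≤ n) :
    wordHeight (Function.update w n c) i = wordHeight w i :=
  Finset.sum_congr rfl fun j hj => by
    rw [Function.update_of_ne (by have := Finset.mem_range.1 hj; omega)]

theorem wordHeight_update_succ :
    wordHeight (Function.update w n c) (n + 1) = wordHeight w n + c := by
  rw [wordHeight, Finset.sum_range_succ, ← wordHeight, wordHeight_update_of_le _ _ _ le_rfl,
    Function.update_self]

theorem wordZeros_update_succ :
    wordZeros (Function.update w n c) (n + 1) = wordZeros w n + if c = 0 then 1 else 0 := by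
  unfold wordZeros
  rw [Finset.card_filter, Finset.card_filter, Finset.sum_range_succ, Function.update_self]
  congr 1
  exact Finset.sum_congr rfl fun j hj => by
    rw [Function.update_of_ne (by have := Finset.mem_range.1 hj; omega)]

theorem isMotzkinPrefix_update_succ :
    IsMotzkinPrefix (Function.update w n c) (n + 1) ↔
      IsMotzkinPrefix w n ∧ 0 ≤ wordHeight w n + c ∧ (c = 0 → wordHeight w n = 0) := by
  constructor
  · rintro ⟨h1, h2⟩
    refine ⟨⟨fun i hi => ?_, fun i hi h0 => ?_⟩, ?_, fun h0 => ?_⟩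
    · rw [← wordHeight_update_of_le w n c hi]
      exact h1 i (by omega)
    · rw [← wordHeight_update_of_le w n c hi.le]
      exact h2 i (by omega) (by rwa [Function.update_of_ne hi.ne])
    · rw [← wordHeight_update_succ]
      exact h1 _ le_rfl
    · rw [← wordHeight_update_of_le w n c le_rfl]
      exact h2 n (by omega) (by rwa [Function.update_self])
  · rintro ⟨⟨h1, h2⟩, h3, h4⟩
    refine ⟨fun i hi => ?_, fun i hi h0 => ?_⟩
    · rcases hi.eq_or_lt with rfl | hi
      · rwa [wordHeight_update_succ]
      · rw [wordHeight_update_of_le _ _ _ (by omega)]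
        exact h1 i (by omega)
    · rw [wordHeight_update_of_le _ _ _ (by omega)]
      rcases (Nat.lt_succ_iff.1 hi).eq_or_lt with rfl | hi
      · exact h4 (by rwa [Function.update_self] at h0)
      · exact h2 i hi (by rwa [Function.update_of_ne hi.ne] at h0)

open Classical in
theorem wordPeaks_update_succ :
    wordPeaks (Function.update w n c) (n + 1) =
      if (∃ i, i + 1 = n ∧ w i = 1) ∧ c = -1 then insert n (wordPeaks w n) else wordPeaks w n := by
  ext d
  have key : d ∈ wordPeaks (Function.update w n c) (n + 1) ↔
      (d = n ∧ (∃ i, i + 1 = n ∧ w i = 1) ∧ c = -1) ∨ d ∈ wordPeaks w n := by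
    simp only [wordPeaks, Finset.mem_filter, Finset.mem_range]
    rcases lt_trichotomy d n with h | rfl | h
    · simp only [h, show d < n + 1 by omega, h.ne, true_and, false_and, false_or]
      refine exists_congr fun i => and_congr_right fun hi => ?_
      rw [Function.update_of_ne (by omega), Function.update_of_ne (by omega)]
    · simp only [Function.update_self, lt_irrefl, false_and, or_false, true_and,
        show d < d + 1 by omega]
      constructor
      · rintro ⟨i, hi, h1, h2⟩
        rw [Function.update_of_ne (by omega)] at h1
        exact ⟨⟨i, hi, h1⟩, h2⟩
      · rintro ⟨⟨i, hi, h1⟩, h2⟩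
        refine ⟨i, hi, ?_, h2⟩
        rwa [Function.update_of_ne (by omega)]
    · simp [h.ne', show ¬ d < n + 1 by omega, show ¬ d < n by omega]
  rw [key]
  split_ifs with h <;> simp [h]

theorem notMem_wordPeaks : n ∉ wordPeaks w n := by simp [wordPeaks]

end update

open Classical in
/-- The generating function of Motzkin prefixes of length `n` with `f` level steps ending at
height `h`, with `k` peaks. -/
noncomputable def wordGF (n : ℕ) (h f k : ℤ) : ℤ[X] :=
  ∑ w ∈ signWords n,
    if IsMotzkinPrefix w n ∧ wordHeight w n = h ∧ (wordZeros w n : ℤ) = f ∧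
      ((wordPeaks w n).card : ℤ) = k then X ^ (∑ d ∈ wordPeaks w n, d) else 0

open Classical in
/-- The part of `wordGF` coming from words whose last letter is `1`. -/
noncomputable def wordGFUp (n : ℕ) (h f k : ℤ) : ℤ[X] :=
  ∑ w ∈ signWords n,
    if ∃ i, i + 1 = n ∧ w i = 1 then
      (if IsMotzkinPrefix w n ∧ wordHeight w n = h ∧ (wordZeros w n : ℤ) = f ∧
      ((wordPeaks w n).card : ℤ) = k then X ^ (∑ d ∈ wordPeaks w n, d) else 0) else 0

theorem wordGF_of_height_neg (n : ℕ) {h : ℤ} (hh : h < 0) (f k : ℤ) : wordGF n h f k = 0 := by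
  refine Finset.sum_eq_zero fun w _ => if_neg ?_
  rintro ⟨h1, h2, -⟩
  have := h1.1 n le_rfl
  omega

theorem wordGF_of_zeros_neg (n : ℕ) (h : ℤ) {f : ℤ} (hf : f < 0) (k : ℤ) : wordGF n h f k = 0 :=
  Finset.sum_eq_zero fun w _ => if_neg <| by omega

open Classical in
theorem sum_update_one (n : ℕ) (h f k : ℤ) :
    (∑ w ∈ signWords n, if IsMotzkinPrefix (Function.update w n 1) (n + 1) ∧
      wordHeight (Function.update w n 1) (n + 1) = h ∧
      (wordZeros (Function.update w n 1) (n + 1) : ℤ) = f ∧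
      ((wordPeaks (Function.update w n 1) (n + 1)).card : ℤ) = k then
        (X : ℤ[X]) ^ (∑ d ∈ wordPeaks (Function.update w n 1) (n + 1), d) else 0)
      = wordGF n (h - 1) f k := by
  refine Finset.sum_congr rfl fun w _ => ?_
  simp only [isMotzkinPrefix_update_succ, wordHeight_update_succ, wordZeros_update_succ,
    wordPeaks_update_succ]
  simp only [show ¬ ((1 : SignType) = -1) by decide, show ¬ ((1 : SignType) = 0) by decide,
    and_false, if_false, SignType.coe_one, false_imp_iff, and_true, add_zero]
  refine if_congr ?_ rfl rfl
  constructor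
  · rintro ⟨⟨h1, -⟩, h2, h3⟩
    exact ⟨h1, by omega, h3⟩
  · rintro ⟨h1, h2, h3⟩
    have := h1.1 n le_rfl
    exact ⟨⟨h1, by omega⟩, by omega, h3⟩

theorem wordGFUp_succ (n : ℕ) (h f k : ℤ) : wordGFUp (n + 1) h f k = wordGF n (h - 1) f k := by
  classical
  rw [wordGFUp, sum_signWords_succ, ← sum_update_one]
  simp

theorem wordGFUp_zero (h f k : ℤ) : wordGFUp 0 h f k = 0 := by simp [wordGFUp]

theorem wordGF_succ (n : ℕ) {h : ℤ} (hh : 0 ≤ h) (f k : ℤ) :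
    wordGF (n + 1) h f k = wordGF n (h - 1) f k + (if h = 0 then wordGF n 0 (f - 1) k else 0)
      + (wordGF n (h + 1) f k - wordGFUp n (h + 1) f k
        + X ^ n * wordGFUp n (h + 1) f (k - 1)) := by
  classical
  rw [wordGF, sum_signWords_succ, sum_update_one]
  congr 1
  · congr 1
    split_ifs with h0
    · refine Finset.sum_congr rfl fun w _ => ?_
      simp only [isMotzkinPrefix_update_succ, wordHeight_update_succ, wordZeros_update_succ,
        wordPeaks_update_succ]
      simp only [show ¬ ((0 : SignType) = -1) by decide, and_false, if_false, SignType.coe_zero,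
        if_true, add_zero]
      refine if_congr ?_ rfl rfl
      push_cast
      constructor
      · rintro ⟨⟨h1, -⟩, h2, h3, h4⟩
        exact ⟨h1, by omega, by omega, h4⟩
      · rintro ⟨h1, h2, h3, h4⟩
        exact ⟨⟨h1, by omega, fun _ => h2⟩, by omega, by omega, h4⟩
    · refine Finset.sum_eq_zero fun w _ => if_neg ?_
      rw [isMotzkinPrefix_update_succ, wordHeight_update_succ]
      rintro ⟨⟨-, -, h1⟩, h2, -⟩
      have := h1 rfl
      simp at h2
      omega
  · rw [wordGF, wordGFUp, wordGFUp, Finset.mul_sum, ← Finset.sum_sub_distrib,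
      ← Finset.sum_add_distrib]
    refine Finset.sum_congr rfl fun w _ => ?_
    simp only [isMotzkinPrefix_update_succ, wordHeight_update_succ, wordZeros_update_succ,
      wordPeaks_update_succ]
    simp only [show ¬ ((-1 : SignType) = 0) by decide, and_true, if_false, SignType.coe_neg,
      SignType.coe_one, false_imp_iff, add_zero]
    have e : (∀ P : Prop, (IsMotzkinPrefix w n ∧ 0 ≤ wordHeight w n + -1) ∧
        wordHeight w n + -1 = h ∧ P ↔ IsMotzkinPrefix w n ∧ wordHeight w n = h + 1 ∧ P) := by
      intro P
      constructor
      · rintro ⟨⟨h1, -⟩, h2, h3⟩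
        exact ⟨h1, by omega, h3⟩
      · rintro ⟨h1, h2, h3⟩
        exact ⟨⟨h1, by omega⟩, by omega, h3⟩
    simp only [e]
    by_cases hu : ∃ i, i + 1 = n ∧ w i = 1
    · simp only [hu, if_true, sub_self, zero_add, Finset.card_insert_of_notMem
        (notMem_wordPeaks w n), Finset.sum_insert (notMem_wordPeaks w n), pow_add, mul_ite, mul_zero]
      refine if_congr ?_ rfl rfl
      push_cast
      simp only [eq_sub_iff_add_eq]
    · simp only [hu, if_false, sub_zero, mul_zero, add_zero]

/-- The right side sees `h` and `f` only through their sum, and so does the recursion. Strong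
induction is needed because a peak removes two letters. -/
theorem wordGF_eq_ballotGF (n : ℕ) (a b h f k : ℤ) (hn : a + b = n) (hh : 0 ≤ h) (hf : 0 ≤ f)
    (hl : h + f = b - a) : wordGF n h f k = ballotGF a b k := by
  induction n using Nat.strong_induction_on generalizing a b h f k with
  | _ n ih =>
    cases n with
    | zero =>
      classical
      simp only [wordGF, signWords, Finset.sum_singleton]
      simp only [wordHeight, wordZeros, wordPeaks, IsMotzkinPrefix, Finset.range_zero,
        Finset.sum_empty, Finset.filter_empty, Finset.card_empty, pow_zero]
      rcases lt_or_eq_of_le (show a ≤ 0 by omega) with ha | rfl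
      · rw [ballotGF_of_neg_left ha, if_neg]
        push_cast
        omega
      · obtain ⟨rfl, rfl, rfl⟩ : b = 0 ∧ h = 0 ∧ f = 0 := by push_cast at hn; omega
        rw [ballotGF, latticeGF_of_neg_left (show (0 : ℤ) - 1 < 0 by omega)]
        rcases lt_trichotomy k 0 with hk | rfl | hk
        · simp [latticeGF, hk, hk.ne']
        · simp [latticeGF, qBinom, gaussBinom_zero_right]
        · obtain ⟨k, rfl⟩ : ∃ m : ℕ, k = m + 1 := ⟨(k - 1).toNat, by omega⟩
          rw [if_neg (by push_cast; omega), show (k : ℤ) + 1 = ((k + 1 : ℕ) : ℤ) by push_cast; ring,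
            show (0 : ℤ) = ((0 : ℕ) : ℤ) by rfl, latticeGF_natCast]
          simp [gaussBinom]
    | succ n =>
      push_cast at hn
      rw [wordGF_succ n hh, ballotGF_rec a b k (by omega) (by omega),
        show (a + b - 1).toNat = n by omega, ih n (by omega) (a - 1) b (h + 1) f k (by omega)
        (by omega) hf (by omega)]
      have hup : ∀ k, wordGFUp n (h + 1) f k = ballotGF (a - 1) (b - 1) k := by
        intro k
        cases n with
        | zero => rw [wordGFUp_zero, ballotGF_of_neg_left (by push_cast at hn; omega)]
        | succ n =>
          rw [wordGFUp_succ]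
          push_cast at hn
          exact ih n (by omega) _ _ _ _ _ (by omega) (by omega) hf (by omega)
      -- At most one of the two terms survives: an up step cannot end at height zero, and a level
      -- step cannot end above it. For `h = f = 0` neither does, which matches `ballotGF_reflect`.
      have hlast : wordGF n (h - 1) f k + (if h = 0 then wordGF n 0 (f - 1) k else 0)
          = ballotGF a (b - 1) k := by
        rcases hh.eq_or_lt with rfl | hh
        · rw [wordGF_of_height_neg n (by omega), if_pos rfl, zero_add]
          rcases hf.eq_or_lt with rfl | hf
          · rw [wordGF_of_zeros_neg n _ (by omega), show b = a by omega, ballotGF_reflect]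
          · exact ih n (by omega) _ _ _ _ _ (by omega) le_rfl (by omega) (by omega)
        · rw [if_neg hh.ne', add_zero]
          exact ih n (by omega) _ _ _ _ _ (by omega) (by omega) hf (by omega)
      rw [hup, hup, hlast]
      ring

/-! ### Involutions and words -/

theorem wordHeight_eq_count_sub (w : ℕ → SignType) (n : ℕ) :
    wordHeight w n = (Nat.count (w · = 1) n : ℤ) - Nat.count (w · = -1) n := by
  induction n with
  | zero => simp [wordHeight]
  | succ n ih =>
    rw [wordHeight, Finset.sum_range_succ, ← wordHeight, ih, Nat.count_succ, Nat.count_succ]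
    cases w n <;> simp <;> ring

/-- The `321`-avoiding involutions of `{0, …, n - 1}`, extended to `ℕ` by the identity. -/
structure IsInvolution321 (n : ℕ) (p : ℕ → ℕ) : Prop where
  involutive : ∀ i, p (p i) = i
  fixed : ∀ i, n ≤ i → p i = i
  avoids : ∀ i j k, i < j → j < k → p k < p j → ¬ p j < p i

/-- The letter `1` marks excedances, the letter `-1` anti-excedances and `0` fixed points. -/
noncomputable def excedanceWord (p : ℕ → ℕ) (i : ℕ) : SignType := SignType.sign ((p i : ℤ) - i)

section excedanceWord
variable {p : ℕ → ℕ} {i : ℕ}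

theorem excedanceWord_eq_one : excedanceWord p i = 1 ↔ i < p i := by
  rw [excedanceWord, sign_eq_one_iff]
  omega

theorem excedanceWord_eq_neg_one : excedanceWord p i = -1 ↔ p i < i := by
  rw [excedanceWord, sign_eq_neg_one_iff]
  omega

theorem excedanceWord_eq_zero : excedanceWord p i = 0 ↔ p i = i := by
  rw [excedanceWord, sign_eq_zero_iff]
  omega

end excedanceWord

/-! ### From involutions to words -/

namespace IsInvolution321
variable {n : ℕ} {p : ℕ → ℕ}

theorem lt (hp : IsInvolution321 n p) {i : ℕ} (hi : i < n) : p i < n := by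
  by_contra h
  have := hp.fixed _ (not_lt.1 h)
  rw [hp.involutive] at this
  omega

/-- Otherwise the positions `i < j < p j` carry the values `p i > p j > j`, a 321. -/
theorem lt_of_lt_of_excedance (hp : IsInvolution321 n p) {i j : ℕ} (hij : i < j) (hj : j < p j) : p i < p j := by
  by_contra h
  have hne : p i ≠ p j := fun e => by
    have := hp.involutive i
    rw [e, hp.involutive] at this
    omega
  have := hp.avoids i j (p j) hij hj (by rw [hp.involutive]; exact hj)
  omega

theorem count_neg_le (hp : IsInvolution321 n p) (i : ℕ) :
    Nat.count (excedanceWord p · = -1) i ≤ Nat.count (excedanceWord p · = 1) i := by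
  rw [Nat.count_eq_card_filter_range, Nat.count_eq_card_filter_range]
  refine Finset.card_le_card_of_injOn p (fun x hx => ?_) fun x _ y _ h => by
    rw [← hp.involutive x, h, hp.involutive]
  simp only [Finset.coe_filter, Finset.mem_range, Set.mem_ofPred_eq, excedanceWord_eq_neg_one,
    excedanceWord_eq_one, hp.involutive] at hx ⊢
  omega

theorem count_eq_of_forall (hp : IsInvolution321 n p) {i : ℕ} (h : ∀ x < i, x < p x → p x < i) :
    Nat.count (excedanceWord p · = 1) i = Nat.count (excedanceWord p · = -1) i := by
  refine le_antisymm ?_ (hp.count_neg_le i)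
  rw [Nat.count_eq_card_filter_range, Nat.count_eq_card_filter_range]
  refine Finset.card_le_card_of_injOn p (fun x hx => ?_) fun x _ y _ h => by
    rw [← hp.involutive x, h, hp.involutive]
  simp only [Finset.coe_filter, Finset.mem_range, Set.mem_ofPred_eq, excedanceWord_eq_neg_one,
    excedanceWord_eq_one, hp.involutive] at hx ⊢
  exact ⟨h x hx.1 hx.2, hx.2⟩

/-- As `p` increases on excedances, it matches those before `i` with the anti-excedances before `p
i`. Thus the `r`-th `1` goes to the `r`-th `-1`. -/
theorem count_apply (hp : IsInvolution321 n p) {i : ℕ} (hi : i < p i) :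
    Nat.count (excedanceWord p · = -1) (p i) = Nat.count (excedanceWord p · = 1) i := by
  rw [Nat.count_eq_card_filter_range, Nat.count_eq_card_filter_range]
  refine Finset.card_bij (fun x _ => p x) (fun x hx => ?_) (fun x _ y _ h => by
    rw [← hp.involutive x, h, hp.involutive]) fun y hy => ⟨p y, ?_, hp.involutive y⟩
  · simp only [Finset.mem_filter, Finset.mem_range, excedanceWord_eq_neg_one,
      excedanceWord_eq_one, hp.involutive] at hx ⊢
    refine ⟨?_, hx.2⟩
    by_contra h
    rcases (not_lt.1 h).eq_or_lt with h | h
    · have := hp.involutive x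
      rw [← h] at this
      omega
    · have := hp.lt_of_lt_of_excedance h (by rw [hp.involutive]; exact hx.2)
      rw [hp.involutive] at this
      omega
  · simp only [Finset.mem_filter, Finset.mem_range, excedanceWord_eq_neg_one,
      excedanceWord_eq_one, hp.involutive] at hy ⊢
    exact ⟨hp.lt_of_lt_of_excedance hy.1 hi, hy.2⟩

theorem mem_signWords (hp : IsInvolution321 n p) : excedanceWord p ∈ signWords n :=
  _root_.mem_signWords.2 fun i hi => excedanceWord_eq_zero.2 (hp.fixed i hi)

theorem isMotzkinPrefix (hp : IsInvolution321 n p) : IsMotzkinPrefix (excedanceWord p) n := by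
  refine ⟨fun i _ => ?_, fun i _ h0 => ?_⟩
  · rw [wordHeight_eq_count_sub]
    have := hp.count_neg_le i
    omega
  · rw [excedanceWord_eq_zero] at h0
    rw [wordHeight_eq_count_sub, hp.count_eq_of_forall fun x hx hxp => ?_, sub_self]
    -- An excedance `x` crossing the fixed point `i` gives the 321 with values `p x > i > x`.
    by_contra h
    rcases (not_lt.1 h).eq_or_lt with h | h
    · have := hp.involutive x
      rw [← h, h0] at this
      omega
    · exact hp.avoids x i (p x) hx h (by rw [hp.involutive, h0]; exact hx) (by rwa [h0])

theorem wordHeight_eq_zero (hp : IsInvolution321 n p) : wordHeight (excedanceWord p) n = 0 := by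
  rw [wordHeight_eq_count_sub, hp.count_eq_of_forall fun x hx _ => hp.lt hx, sub_self]

/-- Any other descent extends to a 321: by the later position `p i` if `i` is an excedance, by the
earlier position `p (i + 1)` if not. -/
theorem lt_succ_iff (hp : IsInvolution321 n p) (i : ℕ) : p (i + 1) < p i ↔ i < p i ∧ p (i + 1) < i + 1 := by
  refine ⟨fun h => ?_, fun h => by omega⟩
  by_contra hc
  rcases lt_or_ge i (p i) with h1 | h1
  · have h2 : i + 1 ≤ p (i + 1) := by omega
    exact hp.avoids i (i + 1) (p i) (by omega) (by omega) (by rw [hp.involutive]; omega) h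
  · exact hp.avoids (p (i + 1)) i (i + 1) (by omega) (by omega) h (by rw [hp.involutive]; omega)

theorem eq_of_excedanceWord_eq (hp : IsInvolution321 n p) {p' : ℕ → ℕ} (hp' : IsInvolution321 n p')
    (h : excedanceWord p = excedanceWord p') : p = p' := by
  have key : ∀ i, i < p i → p i = p' i := by
    intro i hi
    have hi' : i < p' i := by rwa [← excedanceWord_eq_one, ← h, excedanceWord_eq_one]
    have h1 := hp.count_apply hi
    have h2 := hp'.count_apply hi'
    rw [h] at h1
    refine Nat.count_injective (p := (excedanceWord p' · = -1)) ?_ ?_ (h1.trans h2.symm)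
    · rw [← h, excedanceWord_eq_neg_one, hp.involutive]
      exact hi
    · rw [excedanceWord_eq_neg_one, hp'.involutive]
      exact hi'
  funext i
  rcases lt_trichotomy i (p i) with hi | hi | hi
  · exact key i hi
  · rw [← hi]
    exact (excedanceWord_eq_zero.1 (by rw [← h]; exact excedanceWord_eq_zero.2 hi.symm)).symm
  · have := key (p i) (by rwa [hp.involutive])
    rw [hp.involutive] at this
    rw [congrArg p' this, hp'.involutive]

end IsInvolution321

/-- The involution exchanging the `r`-th letter `1` with the `r`-th letter `-1`. -/
noncomputable def wordInvolution (w : ℕ → SignType) (i : ℕ) : ℕ :=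
  if w i = 1 then Nat.nth (w · = -1) (Nat.count (w · = 1) i)
  else if w i = -1 then Nat.nth (w · = 1) (Nat.count (w · = -1) i) else i

/-! ### From words to involutions -/

section wordInvolution
variable {n : ℕ} {w : ℕ → SignType}

theorem card_letter_eq_count (hw : w ∈ signWords n) {c : SignType} (hc : c ≠ 0)
    (hf : (Set.ofPred (w · = c)).Finite) : hf.toFinset.card = Nat.count (w · = c) n := by
  rw [Nat.count_eq_card_filter_range]
  congr 1
  ext i
  simp only [Set.Finite.mem_toFinset, Finset.mem_filter, Finset.mem_range]
  refine ⟨fun h => ⟨?_, h⟩, fun h => h.2⟩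
  by_contra hi
  exact hc (h.symm.trans (mem_signWords.1 hw i (not_lt.1 hi)))

theorem nth_count_letter (hw : w ∈ signWords n) {c d : SignType} (hc : c ≠ 0) (hd : d ≠ 0)
    (hcd : Nat.count (w · = c) n = Nat.count (w · = d) n) {i : ℕ} (hi : w i = c) :
    w (Nat.nth (w · = d) (Nat.count (w · = c) i)) = d ∧
      Nat.count (w · = d) (Nat.nth (w · = d) (Nat.count (w · = c) i)) =
        Nat.count (w · = c) i := by
  have hin : i < n := by
    by_contra h
    exact hc (hi.symm.trans (mem_signWords.1 hw i (not_lt.1 h)))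
  -- This bound keeps `Nat.nth` away from its default value `0`.
  have hlt : ∀ hf : (Set.ofPred (w · = d)).Finite, Nat.count (w · = c) i < hf.toFinset.card :=
    fun hf => by
      rw [card_letter_eq_count hw hd, ← hcd]
      exact Nat.count_strict_mono hi hin
  exact ⟨Nat.nth_mem _ hlt, Nat.count_nth hlt⟩

theorem wordInvolution_of_one (hw : w ∈ signWords n) (h0 : wordHeight w n = 0) {i : ℕ} (hi : w i = 1) :
    w (wordInvolution w i) = -1 ∧
      Nat.count (w · = -1) (wordInvolution w i) = Nat.count (w · = 1) i := by
  rw [wordHeight_eq_count_sub] at h0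
  rw [wordInvolution, if_pos hi]
  exact nth_count_letter hw (by decide) (by decide) (by omega) hi

theorem wordInvolution_of_neg_one (hw : w ∈ signWords n) (h0 : wordHeight w n = 0) {i : ℕ} (hi : w i = -1) :
    w (wordInvolution w i) = 1 ∧
      Nat.count (w · = 1) (wordInvolution w i) = Nat.count (w · = -1) i := by
  rw [wordHeight_eq_count_sub] at h0
  rw [wordInvolution, if_neg (by rw [hi]; decide), if_pos hi]
  exact nth_count_letter hw (by decide) (by decide) (by omega) hi

theorem wordInvolution_of_zero {i : ℕ} (hi : w i = 0) :
    wordInvolution w i = i := by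
  rw [wordInvolution, if_neg (by rw [hi]; decide), if_neg (by rw [hi]; decide)]

theorem wordInvolution_involutive (hw : w ∈ signWords n) (h0 : wordHeight w n = 0) (i : ℕ) : wordInvolution w (wordInvolution w i) = i := by
  rcases SignType.trichotomy (w i) with hi | hi | hi
  · obtain ⟨h1, h2⟩ := wordInvolution_of_neg_one hw h0 hi
    rw [wordInvolution, if_pos h1, h2]
    exact Nat.nth_count (p := (w · = -1)) hi
  · rw [wordInvolution_of_zero hi, wordInvolution_of_zero hi]
  · obtain ⟨h1, h2⟩ := wordInvolution_of_one hw h0 hi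
    rw [wordInvolution, if_neg (by rw [h1]; decide), if_pos h1, h2]
    exact Nat.nth_count (p := (w · = 1)) hi

theorem wordInvolution_lt_of_one_of_one (hw : w ∈ signWords n) (h0 : wordHeight w n = 0) {i j : ℕ} (hi : w i = 1) (hj : w j = 1) (hij : i < j) :
    wordInvolution w i < wordInvolution w j := by
  refine Nat.lt_of_count_lt_count (p := (w · = -1)) ?_
  rw [(wordInvolution_of_one hw h0 hi).2, (wordInvolution_of_one hw h0 hj).2]
  exact Nat.count_strict_mono hi hij

theorem wordInvolution_lt_of_neg_one_of_neg_one (hw : w ∈ signWords n) (h0 : wordHeight w n = 0) {i j : ℕ} (hi : w i = -1) (hj : w j = -1)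
    (hij : i < j) : wordInvolution w i < wordInvolution w j := by
  refine Nat.lt_of_count_lt_count (p := (w · = 1)) ?_
  rw [(wordInvolution_of_neg_one hw h0 hi).2, (wordInvolution_of_neg_one hw h0 hj).2]
  exact Nat.count_strict_mono hi hij

theorem lt_of_letter_ne_zero (hw : w ∈ signWords n) {i : ℕ} (hi : w i ≠ 0) : i < n := by
  by_contra h
  exact hi (mem_signWords.1 hw i (not_lt.1 h))

theorem lt_wordInvolution_of_one (hw : w ∈ signWords n) (h0 : wordHeight w n = 0) (hM : IsMotzkinPrefix w n) {i : ℕ} (hi : w i = 1) :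
    i < wordInvolution w i := by
  obtain ⟨h1, h2⟩ := wordInvolution_of_one hw h0 hi
  by_contra h
  rcases (not_lt.1 h).eq_or_lt with h | h
  · rw [h, hi] at h1
    exact absurd h1 (by decide)
  · have hin := lt_of_letter_ne_zero hw (by rw [hi]; decide : w i ≠ 0)
    -- If the partner came before `i`, the path just after it would have made more down than up
    -- steps.
    have := hM.1 (wordInvolution w i + 1) (by omega)
    rw [wordHeight_eq_count_sub, Nat.count_succ (w · = -1), if_pos h1, h2] at this
    have hle := Nat.count_monotone (w · = 1) (Nat.succ_le_of_lt h)
    simp only [Nat.succ_eq_add_one] at hle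
    omega

theorem wordInvolution_lt_of_neg_one (hw : w ∈ signWords n) (h0 : wordHeight w n = 0) (hM : IsMotzkinPrefix w n) {i : ℕ} (hi : w i = -1) :
    wordInvolution w i < i := by
  have := lt_wordInvolution_of_one hw h0 hM (wordInvolution_of_neg_one hw h0 hi).1
  rwa [wordInvolution_involutive hw h0] at this

theorem excedanceWord_wordInvolution (hw : w ∈ signWords n) (h0 : wordHeight w n = 0) (hM : IsMotzkinPrefix w n) :
    excedanceWord (wordInvolution w) = w := by
  funext i
  rcases SignType.trichotomy (w i) with hi | hi | hi
  · rw [hi, excedanceWord_eq_neg_one]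
    exact wordInvolution_lt_of_neg_one hw h0 hM hi
  · rw [hi, excedanceWord_eq_zero]
    exact wordInvolution_of_zero hi
  · rw [hi, excedanceWord_eq_one]
    exact lt_wordInvolution_of_one hw h0 hM hi

theorem isInvolution321_wordInvolution (hw : w ∈ signWords n) (h0 : wordHeight w n = 0) (hM : IsMotzkinPrefix w n) :
    IsInvolution321 n (wordInvolution w) where
  involutive := wordInvolution_involutive hw h0
  fixed i hi := wordInvolution_of_zero (mem_signWords.1 hw i hi)
  avoids i j k hij hjk h1 h2 := by
    have hup : ∀ i, w i = 1 ↔ i < wordInvolution w i := fun i => by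
      rw [← excedanceWord_eq_one, excedanceWord_wordInvolution hw h0 hM]
    have hdown : ∀ i, w i = -1 ↔ wordInvolution w i < i := fun i => by
      rw [← excedanceWord_eq_neg_one, excedanceWord_wordInvolution hw h0 hM]
    rcases SignType.trichotomy (w j) with hj | hj | hj
    · have := (hdown j).1 hj
      have := wordInvolution_lt_of_neg_one_of_neg_one hw h0 hj ((hdown k).2 (by omega)) hjk
      omega
    · rw [wordInvolution_of_zero hj] at h2
      have hi : w i = 1 := (hup i).2 (by omega)
      obtain ⟨h3, h4⟩ := wordInvolution_of_one hw h0 hi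
      have hn := lt_of_letter_ne_zero hw (by rw [h3]; decide : w (wordInvolution w i) ≠ 0)
      -- The pair of `i` and its partner straddles `j`, so more up than down steps precede `j`,
      -- contrary to height zero at the level step.
      have hz := hM.2 j (by omega) hj
      rw [wordHeight_eq_count_sub] at hz
      have h5 := Nat.count_strict_mono (p := (w · = 1)) hi hij
      have h6 := Nat.count_monotone (w · = -1) h2.le
      omega
    · have := (hup j).1 hj
      have := wordInvolution_lt_of_one_of_one hw h0 ((hup i).2 (by omega)) hj hij
      omega

end wordInvolution

/-! ### Permutations as functions on `ℕ` -/

/-- A permutation of `Fin n`, extended to `ℕ` by the identity. -/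
def permFun {n : ℕ} (π : Equiv.Perm (Fin n)) (i : ℕ) : ℕ := if h : i < n then π ⟨i, h⟩ else i

section permFun
variable {n : ℕ} (π : Equiv.Perm (Fin n))

@[simp]
theorem permFun_val (i : Fin n) : permFun π i = π i := by simp [permFun]

theorem permFun_of_le {i : ℕ} (hi : n ≤ i) : permFun π i = i := by simp [permFun, not_lt.2 hi]

theorem permFun_injective : Function.Injective (permFun (n := n)) := fun π σ h =>
  Equiv.ext fun i => Fin.ext <| by rw [← permFun_val, h, permFun_val]

theorem avoidsPattern_revPerm_iff :
    AvoidsPattern π (Fin.revPerm : Equiv.Perm (Fin 3)) ↔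
      ∀ i j k : Fin n, i < j → j < k → π k < π j → ¬ π j < π i := by
  constructor
  · intro h i j k hij hjk h1 h2
    refine h ⟨![i, j, k], ?_, ?_⟩
    · rw [Fin.strictMono_iff_lt_succ]
      intro a
      fin_cases a
      · exact hij
      · exact hjk
    · intro a b
      fin_cases a <;> fin_cases b <;> simp [h1, h2, h1.le, h2.le, h1.trans h2, (h1.trans h2).le]
  · rintro h ⟨f, hf, hp⟩
    exact h (f 0) (f 1) (f 2) (hf (by decide)) (hf (by decide)) ((hp 2 1).2 (by decide))
      ((hp 1 0).2 (by decide))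

theorem isInvolution321_permFun_iff : IsInvolution321 n (permFun π) ↔ π ∈ involutions321 n := by
  classical
  rw [involutions321, Finset.mem_filter, avoidsPattern_revPerm_iff]
  simp only [Finset.mem_univ, true_and]
  constructor
  · intro h
    refine ⟨fun i => Fin.ext ?_, fun i j k hij hjk h1 h2 => ?_⟩
    · rw [← permFun_val, ← permFun_val, h.involutive]
    · refine h.avoids i j k hij hjk ?_ ?_ <;> simpa
  · rintro ⟨h1, h2⟩
    refine ⟨fun i => ?_, fun i => permFun_of_le π, fun i j k hij hjk h3 h4 => ?_⟩
    · rcases lt_or_ge i n with hi | hi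
      · rw [show i = ((⟨i, hi⟩ : Fin n) : ℕ) from rfl, permFun_val, permFun_val, h1]
      · rw [permFun_of_le π hi, permFun_of_le π hi]
    · have hlt : ∀ x, x < n → permFun π x < n := fun x hx => by simp [permFun, hx]
      rcases lt_or_ge k n with hk | hk
      · refine h2 ⟨i, by omega⟩ ⟨j, by omega⟩ ⟨k, hk⟩ hij hjk ?_ ?_ <;>
          rw [Fin.lt_def, ← permFun_val, ← permFun_val] <;> assumption
      · rw [permFun_of_le π hk] at h3
        rcases lt_or_ge j n with hj | hj
        · have := hlt j hj
          omega
        · rw [permFun_of_le π hj] at h3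
          omega

theorem wordZeros_permFun : wordZeros (excedanceWord (permFun π)) n = permFp π := by
  rw [wordZeros, permFp, Finset.card_filter, Finset.card_filter,
    ← Fin.sum_univ_eq_sum_range (fun i => if excedanceWord (permFun π) i = 0 then 1 else 0)]
  simp only [excedanceWord_eq_zero, permFun_val, Fin.val_inj]

variable {π} in
theorem wordPeaks_permFun (hπ : π ∈ involutions321 n) :
    wordPeaks (excedanceWord (permFun π)) n = permDes π := by
  have hp := (isInvolution321_permFun_iff π).2 hπ
  ext d
  simp only [wordPeaks, permDes, Finset.mem_filter, Finset.mem_range, excedanceWord_eq_one,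
    excedanceWord_eq_neg_one]
  refine and_congr_right fun hd => ?_
  constructor
  · rintro ⟨i, rfl, h⟩
    refine ⟨⟨i, by omega⟩, ⟨i + 1, hd⟩, rfl, rfl, ?_⟩
    rw [Fin.lt_def, ← permFun_val, ← permFun_val]
    exact (hp.lt_succ_iff i).2 h
  · rintro ⟨i, j, rfl, hj, h⟩
    refine ⟨i, rfl, (hp.lt_succ_iff i).1 ?_⟩
    rw [← hj]
    simpa using h

theorem exists_permFun_eq {p : ℕ → ℕ} (hp : IsInvolution321 n p) :
    ∃ π : Equiv.Perm (Fin n), permFun π = p := by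
  have hinv : Function.Involutive fun i : Fin n => (⟨p i, hp.lt i.2⟩ : Fin n) := fun i =>
    Fin.ext (hp.involutive i)
  refine ⟨hinv.toPerm, funext fun i => ?_⟩
  rcases lt_or_ge i n with hi | hi
  · simp [permFun, hi]
  · rw [permFun_of_le _ hi, hp.fixed i hi]

end permFun

/-! ### Generating functions of involutions -/

theorem permFp_modEq {n : ℕ} {π : Equiv.Perm (Fin n)} (hπ : π ∈ involutions321 n) :
    permFp π ≡ n [MOD 2] := by
  have h1 : Function.Involutive π := by
    classical
    rw [involutions321, Finset.mem_filter] at hπ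
    exact hπ.2.1
  have h2 : π ^ 2 ^ 1 = 1 := Equiv.ext fun i => by simp [sq, h1 i]
  have h3 := Equiv.Perm.card_compl_support_modEq h2
  rw [Fintype.card_fin] at h3
  convert h3 using 1
  rw [permFp]
  congr 1
  ext i
  simp

theorem permFp_le {n : ℕ} (π : Equiv.Perm (Fin n)) : permFp π ≤ n := by
  simpa [permFp] using Finset.card_filter_le (Finset.univ : Finset (Fin n)) fun i => π i = i

theorem sum_involutions321_eq_wordGF (n l k : ℕ) :
    ∑ π ∈ involutions321 n with permFp π = l ∧ permDesNum π = k, (X : ℤ[X]) ^ permMaj π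
      = wordGF n 0 l k := by
  classical
  rw [wordGF, ← Finset.sum_filter]
  refine Finset.sum_bij (fun π _ => excedanceWord (permFun π)) (fun π hπ => ?_)
    (fun π hπ σ hσ h => ?_) (fun w hw => ?_) (fun π hπ => ?_)
  · obtain ⟨h1, h2, h3⟩ := Finset.mem_filter.1 hπ
    have hp := (isInvolution321_permFun_iff π).2 h1
    refine Finset.mem_filter.2 ⟨hp.mem_signWords, hp.isMotzkinPrefix, hp.wordHeight_eq_zero, ?_, ?_⟩
    · rw [wordZeros_permFun, h2]
    · rw [wordPeaks_permFun h1, ← permDesNum, h3]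
  · exact permFun_injective
      (((isInvolution321_permFun_iff π).2 (Finset.mem_filter.1 hπ).1).eq_of_excedanceWord_eq
        ((isInvolution321_permFun_iff σ).2 (Finset.mem_filter.1 hσ).1) h)
  · obtain ⟨h1, h2, h3, h4, h5⟩ := Finset.mem_filter.1 hw
    have hp := isInvolution321_wordInvolution h1 h3 h2
    obtain ⟨π, hπ⟩ := exists_permFun_eq hp
    have hmem := (isInvolution321_permFun_iff π).1 (hπ ▸ hp)
    have hword : excedanceWord (permFun π) = w := by
      rw [hπ, excedanceWord_wordInvolution h1 h3 h2]
    refine ⟨π, Finset.mem_filter.2 ⟨hmem, ?_, ?_⟩, hword⟩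
    · rw [← hword, wordZeros_permFun] at h4
      exact_mod_cast h4
    · rw [← hword, wordPeaks_permFun hmem] at h5
      exact_mod_cast h5
  · rw [wordPeaks_permFun (Finset.mem_filter.1 hπ).1, permMaj]

theorem sum_involutions321_eq_ballotGF (n l k : ℕ) (a b : ℤ) (hn : a + b = n) (hl : b - a = l) :
    ∑ π ∈ involutions321 n with permFp π = l ∧ permDesNum π = k, (X : ℤ[X]) ^ permMaj π
      = ballotGF a b k := by
  rw [sum_involutions321_eq_wordGF]
  exact wordGF_eq_ballotGF n a b 0 l k hn le_rfl (by omega) (by omega)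

/-- Passing from `(a + 1, b)` to `(a, b + 1)` keeps the length and raises the bound on fixed points
by two. By parity only the least value is lost, and it contributes one reflection difference. -/
theorem sum_involutions321_le_permFp (a b k : ℕ) (hab : a ≤ b) :
    ∑ π ∈ involutions321 (a + b) with (b : ℤ) - (a : ℤ) ≤ (permFp π : ℤ) ∧ permDesNum π = k,
      (X : ℤ[X]) ^ permMaj π = latticeGF a b k := by
  induction a generalizing b with
  | zero =>
    have h := sum_involutions321_eq_ballotGF (0 + b) b k 0 b (by simp) (by simp)
    rw [ballotGF, latticeGF_of_neg_left (show (0 : ℤ) - 1 < 0 by omega), sub_zero] at h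
    rw [Nat.cast_zero, ← h]
    refine Finset.sum_congr (Finset.filter_congr fun π _ => ?_) fun _ _ => rfl
    have := permFp_le π
    omega
  | succ a ih =>
    have h1 := ih (b + 1) (by omega)
    have h2 := sum_involutions321_eq_ballotGF (a + 1 + b) (b - (a + 1)) k (a + 1) b
      (by push_cast; ring) (by omega)
    rw [show a + (b + 1) = a + 1 + b by ring] at h1
    rw [ballotGF, add_sub_cancel_right] at h2
    push_cast at h1 h2 ⊢
    rw [show latticeGF (a + 1) b k = (latticeGF (a + 1) b k - latticeGF a (b + 1) k)
      + latticeGF a (b + 1) k by ring, ← h2, ← h1, ← Finset.sum_union]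
    · refine Finset.sum_congr ?_ fun _ _ => rfl
      rw [← Finset.filter_or]
      refine Finset.filter_congr fun π hπ => ?_
      have := permFp_modEq hπ
      rw [Nat.ModEq] at this
      omega
    · refine Finset.disjoint_filter.2 fun π _ h => ?_
      omega

theorem corollary6p4 :
    (∀ a b k : ℕ, a ≤ b →
      ∑ π ∈ involutions321 (a + b) with (b : ℤ) - (a : ℤ) ≤ (permFp π : ℤ) ∧ permDesNum π = k,
          (X : ℤ[X]) ^ permMaj π
        = X ^ (k ^ 2) * qBinom (a : ℤ) k * qBinom (b : ℤ) k) ∧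
    (∀ n l k : ℕ, l ≡ n [MOD 2] →
      ∑ π ∈ involutions321 n with permFp π = l ∧ permDesNum π = k,
          (X : ℤ[X]) ^ permMaj π
        = X ^ (k ^ 2) *
          (qBinom (((n : ℤ) - (l : ℤ)) / 2) k * qBinom (((n : ℤ) + (l : ℤ)) / 2) k
            - qBinom (((n : ℤ) - (l : ℤ)) / 2 - 1) k
              * qBinom (((n : ℤ) + (l : ℤ)) / 2 + 1) k)) := by
  refine ⟨fun a b k hab => ?_, fun n l k hl => ?_⟩
  · rw [sum_involutions321_le_permFp a b k hab]
    simp [latticeGF]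
  · rw [Nat.ModEq] at hl
    rw [sum_involutions321_eq_ballotGF n l k (((n : ℤ) - l) / 2) (((n : ℤ) + l) / 2) (by omega)
      (by omega)]
    simp only [ballotGF, latticeGF, Int.toNat_natCast, Nat.cast_nonneg, if_true]
    ring
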